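/- Throughout, Hilbert spaces are complex. A linear relation $T$ from a Hilbert space $\mathcal{E}$ to a Hilbert space $\mathcal{F}$ is a linear subspace of $\mathcal{E}\times\mathcal{F}$; it is closed if it is a closed subset. Its domain is $\operatorname{dom}T=\{f:(f,f')\in T\text{ for some }f'\}$, its multivalued part is $\operatorname{mul}T=\{f':(0,f')\in T\}$, its adjoint is $T^*=\{(k,h)\in\mathcal{F}\times\mathcal{E}:(k,f')=(h,f)\text{ for all }(f,f')\in T\}$, and products are $SR=\{(f,f'):(f,\varphi)\in R,\ (\varphi,f')\in S\text{ for some }\varphi\}$. Bounded everywhere defined operators are identified with their graphs. For a closed relation $T$ the operator part is $T_{\rm s}=\{(f,f')\in T: f'\perp\operatorname{mul}T\}$, which is an operator. A relation $K$ in $\mathcal{H}$ is nonnegative selfadjoint if $K=K^*$ and $(f',f)\ge 0$ for all $(f,f')\in K$; every nonnegative selfadjoint relation $H$ has a unique nonnegative selfadjoint square root $H^{1/2}$, that is, $H^{1/2}H^{1/2}=H$. For nonnegative selfadjoint relations $H_1,H_2$ in $\mathcal{H}$ and $c\ge 0$, the inequality $H_1\le c^2H_2$ means $$\operatorname{dom}(H_2^{1/2})_{\rm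 s}\subset\operatorname{dom}(H_1^{1/2})_{\rm s}\quad\text{and}\quad \|(H_1^{1/2})_{\rm s}h\|\le c\,\|(H_2^{1/2})_{\rm s}h\|\ \text{ for all } h\in\operatorname{dom}(H_2^{1/2})_{\rm s}.$$ **Proposition.** Let $\mathcal{H}_A$, $\mathcal{H}_B$ and $\mathcal{H}$ be Hilbert spaces, let $A$ be a closed linear relation from $\mathcal{H}_A$ to $\mathcal{H}$ and let $B$ be a closed linear relation from $\mathcal{H}_B$ to $\mathcal{H}$. Assume that $\operatorname{dom}A^*=\operatorname{dom}B^*$. Then for every $c\ge 0$ the following statements are equivalent: 1. $AA^*\le c^2BB^*$; 2. $AA^*=BMB^*$ for some nonnegative bounded everywhere defined operator $M$ on $\mathcal{H}_B$ with $\|M\|\le c^2$. -/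

import Mathlib

/-- A linear relation from `E` to `F`: a linear subspace of `E × F`.  Its adjoint is Mathlib's
`Submodule.adjoint`; it is closed when it is closed as a subset of `E × F`. -/
abbrev LinRel (E F : Type*) [NormedAddCommGroup E] [InnerProductSpace ℂ E]
    [NormedAddCommGroup F] [InnerProductSpace ℂ F] : Type _ :=
  Submodule ℂ (E × F)

namespace LinRel

section Basic

variable {E F G : Type*} [NormedAddCommGroup E] [InnerProductSpace ℂ E]
  [NormedAddCommGroup F] [InnerProductSpace ℂ F] [NormedAddCommGroup G] [InnerProductSpace ℂ G]

/-- The domain `{f | (f, f') ∈ H for some f'}`. -/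
def dom (H : LinRel E F) : Submodule ℂ E := H.map (LinearMap.fst ℂ E F)

/-- The multivalued part `{f' | (0, f') ∈ H}`. -/
def mul (H : LinRel E F) : Submodule ℂ F := H.comap (LinearMap.inr ℂ E F)

/-- The product `H₂ H₁ = {(f, f') | (f, φ) ∈ H₁ and (φ, f') ∈ H₂ for some φ}`. -/
def comp (H₂ : LinRel F G) (H₁ : LinRel E F) : LinRel E G where
  carrier := {p | ∃ φ : F, (p.1, φ) ∈ H₁ ∧ (φ, p.2) ∈ H₂}
  add_mem' := by
    rintro p q ⟨φ, h1, h2⟩ ⟨ψ, h3, h4⟩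
    exact ⟨φ + ψ, H₁.add_mem h1 h3, H₂.add_mem h2 h4⟩
  zero_mem' := ⟨0, H₁.zero_mem, H₂.zero_mem⟩
  smul_mem' := by
    rintro a p ⟨φ, h1, h2⟩
    exact ⟨a • φ, H₁.smul_mem a h1, H₂.smul_mem a h2⟩

/-- A bounded everywhere defined operator viewed as a linear relation: its graph. -/
def ofCLM (T : E →L[ℂ] F) : LinRel E F := (T : E →ₗ[ℂ] F).graph

/-- The operator part `Hₛ = H ⊖ ({0} × mul H)`: the pairs `(f, f') ∈ H` that are orthogonal to
`{0} × mul H`, that is, those with `f' ⊥ mul H`. -/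
noncomputable def operPart (H : LinRel E F) : LinRel E F := H ⊓ (mul H)ᗮ.comap (LinearMap.snd ℂ E F)

/-- The scalar multiple `a H = {(f, a f') | (f, f') ∈ H}`. -/
noncomputable def scale (a : ℂ) (H : LinRel E F) : LinRel E F :=
  H.map (LinearMap.prodMap LinearMap.id (a • LinearMap.id))

end Basic

section Order

variable {E : Type*} [NormedAddCommGroup E] [InnerProductSpace ℂ E]

/-- `H` is selfadjoint, and `(f', f)` is real and nonnegative for all `(f, f') ∈ H`. -/
def IsNonnegSelfAdjoint (H : LinRel E E) : Prop :=
  Submodule.adjoint H = H ∧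
    ∀ f f' : E, (f, f') ∈ H → 0 ≤ (inner ℂ f f').re ∧ (inner ℂ f f').im = 0

/-- `K` is the square root `H^{1/2}`: the nonnegative selfadjoint relation with `K K = H`
(for a nonnegative selfadjoint `H` in a Hilbert space it exists and is unique). -/
def IsSqrt (K H : LinRel E E) : Prop := IsNonnegSelfAdjoint K ∧ comp K K = H

/-- The order of nonnegative selfadjoint relations: `H₁ ≤ H₂` means that
`dom (H₂^{1/2})ₛ ⊆ dom (H₁^{1/2})ₛ` and `‖(H₁^{1/2})ₛ h‖ ≤ ‖(H₂^{1/2})ₛ h‖` for all `h` in the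
smaller domain. -/
def Le (H₁ H₂ : LinRel E E) : Prop :=
  ∃ K₁ K₂ : LinRel E E, IsSqrt K₁ H₁ ∧ IsSqrt K₂ H₂ ∧
    dom (operPart K₂) ≤ dom (operPart K₁) ∧
    ∀ h k₁ k₂ : E, (h, k₁) ∈ operPart K₁ → (h, k₂) ∈ operPart K₂ → ‖k₁‖ ≤ ‖k₂‖

/-- The inequality `H₁ ≤ c² H₂` for a real number `c ≥ 0`:
`dom (H₂^{1/2})ₛ ⊆ dom (H₁^{1/2})ₛ` and `‖(H₁^{1/2})ₛ h‖ ≤ c ‖(H₂^{1/2})ₛ h‖` for all `h` in the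
smaller domain.  For `c > 0` this is `Le H₁ (c² H₂)` by `leSqMul_iff_le_scale` below.  For `c = 0`
the relation `0 H₂ = {(f, 0) | f ∈ dom H₂}` need not be selfadjoint, and the inequality is
understood in the present sense, in which `0 H₂` keeps the domain of the form of `H₂`. -/
def LeSqMul (c : ℝ) (H₁ H₂ : LinRel E E) : Prop :=
  ∃ K₁ K₂ : LinRel E E, IsSqrt K₁ H₁ ∧ IsSqrt K₂ H₂ ∧
    dom (operPart K₂) ≤ dom (operPart K₁) ∧
    ∀ h k₁ k₂ : E, (h, k₁) ∈ operPart K₁ → (h, k₂) ∈ operPart K₂ → ‖k₁‖ ≤ c * ‖k₂‖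

/-! The scaled inequality agrees with the order for `c > 0`. -/

theorem mem_scale {c : ℝ} (hc : c ≠ 0) (H : LinRel E E) (f g : E) :
    (f, g) ∈ scale (c : ℂ) H ↔ (f, ((c⁻¹ : ℝ) : ℂ) • g) ∈ H := by
  have hc' : (c : ℂ) ≠ 0 := by exact_mod_cast hc
  simp only [scale, Submodule.mem_map, Prod.exists, LinearMap.prodMap_apply, LinearMap.id_apply,
    LinearMap.smul_apply, Prod.mk.injEq]
  constructor
  · rintro ⟨a, b, hab, rfl, rfl⟩
    rwa [Complex.ofReal_inv, inv_smul_smul₀ hc']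
  · intro h
    exact ⟨f, _, h, rfl, by simp [smul_smul, hc']⟩

theorem scale_scale (a b : ℂ) (H : LinRel E E) : scale a (scale b H) = scale (a * b) H := by
  simp only [scale, ← Submodule.map_comp]
  congr 1
  ext <;> simp [smul_smul, mul_comm]

theorem scale_one (H : LinRel E E) : scale 1 H = H := by
  have : LinearMap.prodMap LinearMap.id ((1 : ℂ) • LinearMap.id) =
      (LinearMap.id : E × E →ₗ[ℂ] E × E) := by ext <;> simp
  rw [scale, this, Submodule.map_id]

theorem IsSqrt.scale {c : ℝ} (hc : 0 < c) {K H : LinRel E E} (h : IsSqrt K H) :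
    IsSqrt (LinRel.scale (c : ℂ) K) (LinRel.scale ((c ^ 2 : ℝ) : ℂ) H) := by
  obtain ⟨⟨hsa, hpos⟩, rfl⟩ := h
  have hc0 : c ≠ 0 := hc.ne'
  have hcc : (c : ℂ) ≠ 0 := by exact_mod_cast hc0
  refine ⟨⟨?_, ?_⟩, ?_⟩
  · ext ⟨x, y⟩
    rw [mem_scale hc0]
    conv_rhs => rw [← hsa]
    simp only [Submodule.mem_adjoint_iff, mem_scale hc0]
    constructor
    · intro h a b hab
      have := h a ((c : ℂ) • b) (by rwa [Complex.ofReal_inv, inv_smul_smul₀ hcc])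
      simp only [inner_smul_left, inner_smul_right, Complex.conj_ofReal] at this ⊢
      have h2 : inner ℂ b x - ((c⁻¹ : ℝ) : ℂ) * inner ℂ a y =
        ((c⁻¹ : ℝ) : ℂ) * ((c : ℂ) * inner ℂ b x - inner ℂ a y) := by
        push_cast; field_simp
      rw [h2, this, mul_zero]
    · intro h a b hab
      have := h a _ hab
      simp only [inner_smul_left, inner_smul_right, Complex.conj_ofReal, ← mul_sub] at this
      exact (mul_eq_zero.mp this).resolve_left (by exact_mod_cast inv_ne_zero hc0)
  · intro f f' hf
    rw [mem_scale hc0] at hf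
    have := hpos _ _ hf
    rw [inner_smul_right, Complex.re_ofReal_mul, Complex.im_ofReal_mul] at this
    exact ⟨nonneg_of_mul_nonneg_right this.1 (inv_pos.mpr hc),
      (mul_eq_zero.mp this.2).resolve_left (inv_ne_zero hc0)⟩
  · ext ⟨x, y⟩
    rw [mem_scale (pow_ne_zero 2 hc0)]
    change (∃ φ, _ ∧ _) ↔ ∃ φ, _ ∧ _
    simp only [mem_scale hc0]
    constructor
    · rintro ⟨φ, h1, h2⟩
      refine ⟨_, h1, ?_⟩
      have := K.smul_mem ((c⁻¹ : ℝ) : ℂ) h2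
      simpa [smul_smul, pow_two, mul_comm] using this
    · rintro ⟨φ, h1, h2⟩
      refine ⟨(c : ℂ) • φ, by rwa [Complex.ofReal_inv, inv_smul_smul₀ hcc], ?_⟩
      have := K.smul_mem (c : ℂ) h2
      simpa [smul_smul, pow_two, hcc] using this

theorem mem_operPart_scale {c : ℝ} (hc : c ≠ 0) (K : LinRel E E) (f g : E) :
    (f, g) ∈ operPart (scale (c : ℂ) K) ↔ (f, ((c⁻¹ : ℝ) : ℂ) • g) ∈ operPart K := by
  have hm : mul (scale (c : ℂ) K) = mul K := by
    ext y
    change (0, y) ∈ scale (c : ℂ) K ↔ (0, y) ∈ K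
    rw [mem_scale hc]
    constructor
    · intro h
      simpa [smul_smul, hc] using K.smul_mem (c : ℂ) h
    · intro h
      simpa using K.smul_mem ((c⁻¹ : ℝ) : ℂ) h
  simp only [operPart, hm, Submodule.mem_inf, mem_scale hc, Submodule.mem_comap,
    LinearMap.snd_apply]
  rw [Submodule.smul_mem_iff _ (by exact_mod_cast inv_ne_zero hc)]

theorem dom_operPart_scale {c : ℝ} (hc : c ≠ 0) (K : LinRel E E) :
    dom (operPart (scale (c : ℂ) K)) = dom (operPart K) := by
  have hcc : (c : ℂ) ≠ 0 := by exact_mod_cast hc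
  ext x
  simp only [dom, Submodule.mem_map, Prod.exists, LinearMap.fst_apply, exists_and_right,
    exists_eq_right, mem_operPart_scale hc]
  constructor
  · rintro ⟨y, hy⟩
    exact ⟨_, hy⟩
  · rintro ⟨y, hy⟩
    exact ⟨(c : ℂ) • y, by rwa [Complex.ofReal_inv, inv_smul_smul₀ hcc]⟩

theorem leSqMul_iff_le_scale {c : ℝ} (hc : 0 < c) (H₁ H₂ : LinRel E E) :
    LeSqMul c H₁ H₂ ↔ Le H₁ (scale ((c ^ 2 : ℝ) : ℂ) H₂) := by
  have hc0 : c ≠ 0 := hc.ne'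
  have hcc : (c : ℂ) ≠ 0 := by exact_mod_cast hc0
  constructor
  · rintro ⟨K₁, K₂, h1, h2, hd, hn⟩
    refine ⟨K₁, scale (c : ℂ) K₂, h1, h2.scale hc, by rwa [dom_operPart_scale hc0], ?_⟩
    intro h k₁ k₂ hk₁ hk₂
    have := hn h k₁ _ hk₁ ((mem_operPart_scale hc0 _ _ _).mp hk₂)
    simpa [norm_smul, abs_of_pos hc, hc0] using this
  · rintro ⟨K₁, K₂, h1, h2, hd, hn⟩
    have h3 := h2.scale (inv_pos.mpr hc)
    have h4 : scale (((c⁻¹) ^ 2 : ℝ) : ℂ) (scale ((c ^ 2 : ℝ) : ℂ) H₂) = H₂ := by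
      rw [scale_scale, ← Complex.ofReal_mul, ← mul_pow, inv_mul_cancel₀ hc0]
      simpa using scale_one H₂
    rw [h4] at h3
    refine ⟨K₁, _, h1, h3, by rwa [dom_operPart_scale (inv_ne_zero hc0)], ?_⟩
    intro h k₁ k₂ hk₁ hk₂
    have := hn h k₁ _ hk₁ ((mem_operPart_scale (inv_ne_zero hc0) _ _ _).mp hk₂)
    simpa [norm_smul, abs_of_pos hc] using this

end Order

end LinRel

/-! Put `T₁ = A*` and `T₂ = B*`. As `A` and `B` are closed, they equal their double adjoints, so the
relations compared are `gram T₁ = T₁* T₁` and `gram T₂ = T₂* T₂`.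

The form of `T* T` is `‖Tₛ h‖²` on `dom Tₛ`: it is read off on `dom T* T`, which is a core of `Tₛ`
(`operPart_subset_closure`). Closed relations with the same `T* T`, in particular `T` and a square
root of `T* T`, thus have operator parts with equal domains and norms. The inequality becomes `‖T₁ₛ
h‖ ≤ c ‖T₂ₛ h‖` (`leSqMul_gram_iff`).

Given this bound, Douglas factorization yields `C` with `T₁ₛ = C T₂ₛ` and `C = 0` on `mul T₂`; then
`M = C* C` works because the domains coincide (`gram_eq_of_factor`). Conversely, the factorization
gives the bound on the core (`norm_le_of_mem_comp_ofCLM`), and the closed graph theorem carries it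
to all of `dom T₁` (`norm_operPart_le_of_core`). -/

open scoped InnerProductSpace ComplexOrder

namespace LinRel

/-! ### Adjoints, operator parts and double adjoints -/

section Adjoint

variable {E F : Type*} [NormedAddCommGroup E] [InnerProductSpace ℂ E]
  [NormedAddCommGroup F] [InnerProductSpace ℂ F]

theorem mk_mem_adjoint_iff {T : LinRel E F} {k : F} {h : E} :
    (k, h) ∈ Submodule.adjoint T ↔ ∀ f f', (f, f') ∈ T → ⟪f', k⟫_ℂ = ⟪f, h⟫_ℂ := by
  simp [Submodule.mem_adjoint_iff, sub_eq_zero]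

theorem mem_dom_iff {T : LinRel E F} {f : E} : f ∈ dom T ↔ ∃ f', (f, f') ∈ T := by
  simp [dom]

theorem mem_mul_iff {T : LinRel E F} {f' : F} : f' ∈ mul T ↔ (0, f') ∈ T := Iff.rfl

theorem mem_operPart_iff {T : LinRel E F} {f : E} {f' : F} :
    (f, f') ∈ operPart T ↔ (f, f') ∈ T ∧ f' ∈ (mul T)ᗮ := Iff.rfl

theorem isClosed_adjoint (T : LinRel E F) :
    IsClosed (Submodule.adjoint T : Set (F × E)) := by
  have : (Submodule.adjoint T : Set (F × E)) =
      ⋂ p ∈ T, {x : F × E | ⟪p.2, x.1⟫_ℂ = ⟪p.1, x.2⟫_ℂ} := by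
    ext ⟨k, h⟩
    simp only [SetLike.mem_coe, mk_mem_adjoint_iff, Set.mem_iInter, Set.mem_ofPred_eq, Prod.forall]
  rw [this]
  exact isClosed_biInter fun p _ => isClosed_eq (by fun_prop) (by fun_prop)

theorem isClosed_mul {T : LinRel E F} (hT : IsClosed (T : Set (E × F))) :
    IsClosed (mul T : Set F) :=
  hT.preimage (f := fun y : F => ((0 : E), y)) (by fun_prop)

theorem isClosed_operPart {T : LinRel E F} (hT : IsClosed (T : Set (E × F))) :
    IsClosed (operPart T : Set (E × F)) :=
  hT.inter ((Submodule.isClosed_orthogonal (mul T)).preimage continuous_snd)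

theorem operPart_unique {T : LinRel E F} {f : E} {k k' : F} (h : (f, k) ∈ operPart T)
    (h' : (f, k') ∈ operPart T) : k = k' := by
  rw [mem_operPart_iff] at h h'
  have hm : k - k' ∈ mul T := by
    simpa [mem_mul_iff] using T.sub_mem h.1 h'.1
  have := (mul T).inner_right_of_mem_orthogonal hm ((mul T)ᗮ.sub_mem h.2 h'.2)
  exact sub_eq_zero.mp (inner_self_eq_zero.mp this)

theorem mem_orthogonal_mul_of_mem_adjoint {T : LinRel E F} {k : F} {h : E}
    (hk : (k, h) ∈ Submodule.adjoint T) : k ∈ (mul T)ᗮ := by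
  rw [Submodule.mem_orthogonal]
  intro u hu
  simpa using mk_mem_adjoint_iff.mp hk _ _ hu

/-- Every element of a closed relation is the sum of an element of its operator part and an
element of its multivalued part. -/
theorem exists_mem_operPart_sub_mem_mul [CompleteSpace F] {T : LinRel E F}
    (hT : IsClosed (T : Set (E × F))) {f : E} {f' : F} (h : (f, f') ∈ T) :
    ∃ k, (f, k) ∈ operPart T ∧ f' - k ∈ mul T := by
  have : CompleteSpace (mul T) := (isClosed_mul hT).completeSpace_coe
  refine ⟨f' - (mul T).starProjection f', ⟨?_, ?_⟩, ?_⟩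
  · simpa using T.sub_mem h (mem_mul_iff.mp ((mul T).starProjection_apply_mem f'))
  · exact (mul T).sub_starProjection_mem_orthogonal f'
  · simp

theorem dom_operPart [CompleteSpace F] {T : LinRel E F} (hT : IsClosed (T : Set (E × F))) :
    dom (operPart T) = dom T := by
  ext f
  simp only [mem_dom_iff]
  constructor
  · rintro ⟨k, hk⟩
    exact ⟨k, hk.1⟩
  · rintro ⟨k, hk⟩
    obtain ⟨k', hk', -⟩ := exists_mem_operPart_sub_mem_mul hT hk
    exact ⟨k', hk'⟩

/-- The relation as a subspace of the Hilbert space sum of `E` and `F`. -/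
def hilbertGraph (T : LinRel E F) : Submodule ℂ (WithLp 2 (E × F)) :=
  T.comap (WithLp.linearEquiv 2 ℂ (E × F)).toLinearMap

theorem mem_hilbertGraph_iff {T : LinRel E F} {x : WithLp 2 (E × F)} :
    x ∈ hilbertGraph T ↔ (x.fst, x.snd) ∈ T := Iff.rfl

theorem isClosed_hilbertGraph {T : LinRel E F} (hT : IsClosed (T : Set (E × F))) :
    IsClosed (hilbertGraph T : Set (WithLp 2 (E × F))) :=
  hT.preimage (WithLp.prodContinuousLinearEquiv 2 ℂ E F).continuous

/-- The adjoint is the rotated orthogonal complement of the graph. Hence the double adjoint is a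
double orthogonal complement, and graph projections produce elements of `T*`. -/
theorem mem_hilbertGraph_orthogonal_iff {T : LinRel E F} {x : WithLp 2 (E × F)} :
    x ∈ (hilbertGraph T)ᗮ ↔ (x.snd, -x.fst) ∈ Submodule.adjoint T := by
  rw [Submodule.mem_orthogonal, mk_mem_adjoint_iff]
  constructor
  · intro h f f' hf
    have := h (WithLp.toLp 2 (f, f')) hf
    simp only [WithLp.prod_inner_apply] at this
    rw [inner_neg_right, eq_neg_iff_add_eq_zero, add_comm]
    exact this
  · intro h u hu
    have := h _ _ (mem_hilbertGraph_iff.mp hu)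
    rw [inner_neg_right, eq_neg_iff_add_eq_zero, add_comm] at this
    exact this

theorem adjoint_adjoint [CompleteSpace E] [CompleteSpace F] {T : LinRel E F}
    (hT : IsClosed (T : Set (E × F))) : Submodule.adjoint (Submodule.adjoint T) = T := by
  apply le_antisymm
  · rintro ⟨p, q⟩ hpq
    have : CompleteSpace (hilbertGraph T) := (isClosed_hilbertGraph hT).completeSpace_coe
    suffices WithLp.toLp 2 (p, q) ∈ (hilbertGraph T)ᗮᗮ by
      rwa [Submodule.orthogonal_orthogonal] at this
    rw [Submodule.mem_orthogonal]
    intro u hu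
    have := mk_mem_adjoint_iff.mp hpq _ _ (mem_hilbertGraph_orthogonal_iff.mp hu)
    rw [inner_neg_left, neg_eq_iff_add_eq_zero] at this
    exact this
  · rintro ⟨p, q⟩ hpq
    rw [mk_mem_adjoint_iff]
    intro k h hk
    have := mk_mem_adjoint_iff.mp hk _ _ hpq
    rw [← inner_conj_symm, ← this, inner_conj_symm]

end Adjoint

/-! ### The relation `T* T`: resolvent, square root and core -/

section GramRelation

variable {E F : Type*} [NormedAddCommGroup E] [InnerProductSpace ℂ E]
  [NormedAddCommGroup F] [InnerProductSpace ℂ F]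

/-- The nonnegative relation `T* T`. -/
noncomputable def gram (T : LinRel E F) : LinRel E E := comp (Submodule.adjoint T) T

theorem mem_gram_iff {T : LinRel E F} {f f' : E} :
    (f, f') ∈ gram T ↔ ∃ φ, (f, φ) ∈ T ∧ (φ, f') ∈ Submodule.adjoint T := Iff.rfl

theorem mem_gram_iff_exists_operPart {T : LinRel E F} {f f' : E} :
    (f, f') ∈ gram T ↔ ∃ φ, (f, φ) ∈ operPart T ∧ (φ, f') ∈ Submodule.adjoint T :=
  ⟨fun ⟨φ, h, h'⟩ => ⟨φ, ⟨h, mem_orthogonal_mul_of_mem_adjoint h'⟩, h'⟩,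
    fun ⟨φ, h, h'⟩ => ⟨φ, h.1, h'⟩⟩

variable [CompleteSpace E] [CompleteSpace F]

/-- `T* T` is described by the bounded operator `R = (1 + T* T)⁻¹`. -/
theorem exists_resolvent_gram {T : LinRel E F} (hT : IsClosed (T : Set (E × F))) :
    ∃ R : E →L[ℂ] E, 0 ≤ R ∧ R ≤ 1 ∧
      ∀ f f', (f, f') ∈ gram T ↔ ∃ g, f = R g ∧ f' = g - R g := by
  have : CompleteSpace (hilbertGraph T) := (isClosed_hilbertGraph hT).completeSpace_coe
  -- The operator `R` is the compression of the graph projection to the first component. If `(g, 0)`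
  -- projects to `(f, φ)`, then `(g - f, -φ)` is orthogonal to the graph, that is, `(φ, g - f) ∈
  -- T*`; so `f = R g` and `(f, g - f) ∈ T* T`.
  set P := (hilbertGraph T).starProjection with hP
  let J : E →L[ℂ] WithLp 2 (E × F) :=
    (WithLp.prodContinuousLinearEquiv 2 ℂ E F).symm.toContinuousLinearMap ∘L
      ContinuousLinearMap.inl ℂ E F
  have hJ : ∀ x, J x = WithLp.toLp 2 (x, 0) := fun x => rfl
  have hJa : ∀ w, J.adjoint w = w.fst := fun w =>
    ext_inner_left ℂ fun v => by
      rw [ContinuousLinearMap.adjoint_inner_right, hJ, WithLp.prod_inner_apply]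
      simp
  have hPpos : ∀ (U : Submodule ℂ (WithLp 2 (E × F))) [U.HasOrthogonalProjection],
      U.starProjection.IsPositive := fun U _ =>
    ContinuousLinearMap.IsPositive.of_isStarProjection isStarProjection_starProjection
  have hR : ∀ g, (J.adjoint ∘L P ∘L J) g = (P (WithLp.toLp 2 (g, 0))).fst := fun g => hJa _
  refine ⟨J.adjoint ∘L P ∘L J, ?_, ?_, ?_⟩
  · rw [ContinuousLinearMap.nonneg_iff_isPositive]
    exact (hPpos _).adjoint_conj J
  · rw [ContinuousLinearMap.le_def]
    -- Since `J* J = 1`, the operator `1 - R` is the same compression of the complementary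
    -- projection.
    convert (hPpos (hilbertGraph T)ᗮ).adjoint_conj J using 1
    rw [Submodule.starProjection_orthogonal]
    ext x
    simp [hJa, hJ, hP]
  · intro f f'
    simp only [hR]
    constructor
    · rintro ⟨φ, h1, h2⟩
      have : P (WithLp.toLp 2 (f + f', 0)) = WithLp.toLp 2 (f, φ) := by
        apply Submodule.eq_starProjection_of_mem_orthogonal
        · exact h1
        · rw [mem_hilbertGraph_orthogonal_iff]
          have := neg_mem h2
          simpa using this
      exact ⟨f + f', by rw [this]; rfl, by rw [this]; simp⟩
    · rintro ⟨g, rfl, rfl⟩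
      refine ⟨(P (WithLp.toLp 2 (g, 0))).snd,
        mem_hilbertGraph_iff.mp (Submodule.starProjection_apply_mem _ _), ?_⟩
      have := mem_hilbertGraph_orthogonal_iff.mp
        ((hilbertGraph T).sub_starProjection_mem_orthogonal (WithLp.toLp 2 (g, 0)))
      simpa [← hP] using neg_mem this

/-- A relation of the form `{(R g, g - R g)}` with `0 ≤ R ≤ 1` has the square root
`{(R^{1/2} x, (1 - R)^{1/2} x)}`. -/
theorem exists_isSqrt_of_resolvent {L : LinRel E E} {R : E →L[ℂ] E} (h0 : 0 ≤ R) (h1 : R ≤ 1)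
    (hL : ∀ f f', (f, f') ∈ L ↔ ∃ g, f = R g ∧ f' = g - R g) : ∃ K, IsSqrt K L := by
  set p := CFC.sqrt R
  set q := CFC.sqrt (1 - R)
  have hp0 : 0 ≤ p := CFC.sqrt_nonneg R
  have hq0 : 0 ≤ q := CFC.sqrt_nonneg (1 - R)
  have hpp : p * p = R := CFC.sqrt_mul_sqrt_self R h0
  have hqq : q * q = 1 - R := CFC.sqrt_mul_sqrt_self (1 - R) (sub_nonneg.mpr h1)
  have hpq : Commute p q := by
    have h : Commute R (1 - R) := (Commute.one_right R).sub_right (Commute.refl R)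
    exact ((h.cfcₙ_nnreal NNReal.sqrt).symm.cfcₙ_nnreal NNReal.sqrt).symm
  have hpqx : ∀ x, p (q x) = q (p x) := fun x => DFunLike.congr_fun hpq.eq x
  have hppx : ∀ x, p (p x) = R x := fun x => DFunLike.congr_fun hpp x
  have hqqx : ∀ x, q (q x) = x - R x := fun x => DFunLike.congr_fun hqq x
  have hps := ((ContinuousLinearMap.nonneg_iff_isPositive p).mp hp0).inner_left_eq_inner_right
  have hqs := ((ContinuousLinearMap.nonneg_iff_isPositive q).mp hq0).inner_left_eq_inner_right
  let K : LinRel E E := LinearMap.range ((p : E →ₗ[ℂ] E).prod (q : E →ₗ[ℂ] E))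
  have hK : ∀ f f', (f, f') ∈ K ↔ ∃ x, p x = f ∧ q x = f' := fun f f' => by
    simp [K, LinearMap.mem_range]
  -- As `p² + q² = 1` and `p`, `q` commute, the range `K` is the full solution set of `q k = p h`.
  -- This yields both selfadjointness of `K` and the middle vector in `K K`.
  have key : ∀ k h, q k = p h → ∃ x, p x = k ∧ q x = h := fun k h hkh =>
    ⟨p k + q h, by rw [map_add, hppx, hpqx, ← hkh, hqqx]; abel,
      by rw [map_add, hqqx, ← hpqx, hkh, hppx]; abel⟩
  refine ⟨K, ⟨?_, ?_⟩, ?_⟩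
  · ext ⟨k, h⟩
    rw [mk_mem_adjoint_iff, hK]
    constructor
    · intro H
      refine key k h (ext_inner_left ℂ fun v => ?_)
      rw [← hqs, ← hps]
      exact H _ _ ((hK _ _).mpr ⟨v, rfl, rfl⟩)
    · rintro ⟨x, rfl, rfl⟩ f f' hf
      obtain ⟨y, rfl, rfl⟩ := (hK _ _).mp hf
      rw [hps, hqs, hpqx]
  · intro f f' hf
    obtain ⟨x, rfl, rfl⟩ := (hK _ _).mp hf
    have := ((ContinuousLinearMap.nonneg_iff_isPositive _).mp
      (Commute.mul_nonneg hp0 hq0 hpq)).inner_nonneg_right x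
    change 0 ≤ ⟪x, p (q x)⟫_ℂ at this
    rw [← hps, Complex.nonneg_iff] at this
    exact ⟨this.1, this.2.symm⟩
  · ext ⟨f, f'⟩
    rw [hL]
    constructor
    · rintro ⟨φ, h1, h2⟩
      obtain ⟨x, rfl, rfl⟩ := (hK _ _).mp h1
      obtain ⟨y, h3, rfl⟩ := (hK _ _).mp h2
      obtain ⟨w, rfl, rfl⟩ := key x y h3.symm
      exact ⟨w, hppx w, hqqx w⟩
    · rintro ⟨g, rfl, rfl⟩
      refine ⟨q (p g), (hK _ _).mpr ⟨p g, hppx g, rfl⟩, (hK _ _).mpr ⟨q g, hpqx g, hqqx g⟩⟩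

theorem exists_isSqrt_gram {T : LinRel E F} (hT : IsClosed (T : Set (E × F))) :
    ∃ K, IsSqrt K (gram T) := by
  obtain ⟨R, h0, h1, h⟩ := exists_resolvent_gram hT
  exact exists_isSqrt_of_resolvent h0 h1 h

/-- `dom T* T` is a core of the operator part of a closed relation `T`. -/
theorem operPart_subset_closure {T : LinRel E F} (hT : IsClosed (T : Set (E × F))) :
    (operPart T : Set (E × F)) ⊆
      closure {x | x ∈ operPart T ∧ ∃ f', (x.2, f') ∈ Submodule.adjoint T} := by
  let D : LinRel E F := operPart T ⊓ (dom (Submodule.adjoint T)).comap (LinearMap.snd ℂ E F)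
  have hD : ∀ x, x ∈ D ↔ x ∈ operPart T ∧ ∃ f', (x.2, f') ∈ Submodule.adjoint T := fun x => by
    simp [D, mem_dom_iff]
  have hset : {x | x ∈ operPart T ∧ ∃ f', (x.2, f') ∈ Submodule.adjoint T} = (D : Set (E × F)) :=
    Set.ext fun x => (hD x).symm
  rw [hset]
  have hDc : IsClosed (D.topologicalClosure : Set (E × F)) := D.isClosed_topologicalClosure
  have hle : D.topologicalClosure ≤ operPart T :=
    D.topologicalClosure_minimal inf_le_left (isClosed_operPart hT)
  have : CompleteSpace (hilbertGraph D.topologicalClosure) :=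
    (isClosed_hilbertGraph hDc).completeSpace_coe
  have hle' : hilbertGraph D.topologicalClosure ≤ hilbertGraph (operPart T) :=
    fun x hx => hle hx
  have hbot : (hilbertGraph D.topologicalClosure)ᗮ ⊓ hilbertGraph (operPart T) = ⊥ := by
    rw [eq_bot_iff]
    rintro x ⟨hx, hxT⟩
    have hxT' : (x.fst, x.snd) ∈ operPart T := hxT
    obtain ⟨R, -, -, hR⟩ := exists_resolvent_gram hT
    -- Test `x` against the element `(R x₁, φ)` of `D`, where `(φ, x₁ - R x₁) ∈ T*`. Orthogonality
    -- reads `0 = (x₁, R x₁) + (x₂, φ) = (x₁, R x₁) + (x₁, x₁ - R x₁) = ‖x₁‖²`.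
    obtain ⟨φ, h1, h2⟩ :=
      mem_gram_iff_exists_operPart.mp ((hR _ _).mpr ⟨x.fst, rfl, rfl⟩)
    have h3 := (Submodule.mem_orthogonal _ _).mp hx (WithLp.toLp 2 (R x.fst, φ))
      (D.le_topologicalClosure ((hD _).mpr ⟨h1, _, h2⟩))
    have h4 := mk_mem_adjoint_iff.mp h2 _ _ hxT'.1
    rw [WithLp.prod_inner_apply] at h3
    have h5 : ⟪x.fst, x.fst⟫_ℂ = 0 := by
      have h6 : ⟪x.fst, R x.fst⟫_ℂ + ⟪x.snd, φ⟫_ℂ = 0 := by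
        rw [← inner_conj_symm, ← inner_conj_symm x.snd, ← map_add]
        exact (map_eq_zero _).mpr h3
      rw [h4, inner_sub_right] at h6
      simpa using h6
    rw [inner_self_eq_zero] at h5
    have h7 : x.snd = 0 := by
      rw [h5] at hxT'
      exact operPart_unique hxT' (operPart T).zero_mem
    rw [Submodule.mem_bot]
    exact (WithLp.linearEquiv 2 ℂ (E × F)).injective (Prod.ext h5 h7)
  intro x hx
  have := Submodule.sup_orthogonal_inf_of_hasOrthogonalProjection hle'
  rw [hbot, sup_bot_eq] at this
  have hx' : WithLp.toLp 2 x ∈ hilbertGraph (operPart T) := hx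
  rw [← this] at hx'
  exact hx'

end GramRelation

/-! ### Comparing relations through `T* T` -/

section Comparison

variable {E F F₁ F₂ : Type*} [NormedAddCommGroup E] [InnerProductSpace ℂ E] [CompleteSpace E]
  [NormedAddCommGroup F] [InnerProductSpace ℂ F]
  [NormedAddCommGroup F₁] [InnerProductSpace ℂ F₁] [CompleteSpace F₁]
  [NormedAddCommGroup F₂] [InnerProductSpace ℂ F₂] [CompleteSpace F₂]

omit [CompleteSpace E] in
theorem norm_sq_eq_re_inner_of_mem_gram {T : LinRel E F} {f f' : E} {φ : F}
    (h : (f, φ) ∈ T) (h' : (φ, f') ∈ Submodule.adjoint T) : ‖φ‖ ^ 2 = (⟪f, f'⟫_ℂ).re := by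
  rw [← mk_mem_adjoint_iff.mp h' _ _ h, inner_self_eq_norm_sq_to_K]
  norm_cast

omit [CompleteSpace E] [CompleteSpace F₁] [CompleteSpace F₂] in
-- For `(f, f') ∈ T* T` the squared norm of the intermediate vector is `(f', f)`, which depends on
-- `T* T` alone.
theorem norm_eq_of_gram_eq {T₁ : LinRel E F₁} {T₂ : LinRel E F₂} (h : gram T₁ = gram T₂)
    {f f' : E} {φ : F₁} (hφ : (f, φ) ∈ T₁) (hφ' : (φ, f') ∈ Submodule.adjoint T₁) :
    ∃ ψ, (f, ψ) ∈ operPart T₂ ∧ ‖ψ‖ = ‖φ‖ := by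
  have hf : (f, f') ∈ gram T₂ := h ▸ mem_gram_iff.mpr ⟨φ, hφ, hφ'⟩
  obtain ⟨ψ, hψ, hψ'⟩ := mem_gram_iff_exists_operPart.mp hf
  refine ⟨ψ, hψ, (sq_eq_sq₀ (norm_nonneg _) (norm_nonneg _)).mp ?_⟩
  rw [norm_sq_eq_re_inner_of_mem_gram hψ.1 hψ', norm_sq_eq_re_inner_of_mem_gram hφ hφ']

/-- Closed relations with the same `T* T` have operator parts with the same domain and norms. -/
theorem exists_mem_operPart_of_gram_eq {T₁ : LinRel E F₁} {T₂ : LinRel E F₂}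
    (hT₁ : IsClosed (T₁ : Set (E × F₁))) (hT₂ : IsClosed (T₂ : Set (E × F₂)))
    (h : gram T₁ = gram T₂) {f : E} {k : F₁} (hk : (f, k) ∈ operPart T₁) :
    ∃ k', (f, k') ∈ operPart T₂ ∧ ‖k'‖ = ‖k‖ := by
  obtain ⟨x, hx, hlim⟩ := mem_closure_iff_seq_limit.mp (operPart_subset_closure hT₁ hk)
  have hadj : ∀ n, ∃ f', ((x n).2, f') ∈ Submodule.adjoint T₁ := fun n => (hx n).2
  choose x' hx' using hadj
  choose y hy hyn using fun n => norm_eq_of_gram_eq h (hx n).1.1 (hx' n)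
  -- Differences of core elements are core elements, so equality of norms makes `y` Cauchy along
  -- with the second components of `x`.
  have hdist : ∀ m n, dist (y m) (y n) = dist (x m).2 (x n).2 := fun m n => by
    obtain ⟨z, hz, hzn⟩ := norm_eq_of_gram_eq h (T₁.sub_mem (hx m).1.1 (hx n).1.1)
      ((Submodule.adjoint T₁).sub_mem (hx' m) (hx' n))
    rw [dist_eq_norm, dist_eq_norm,
      operPart_unique ((operPart T₂).sub_mem (hy m) (hy n)) hz, hzn]
  have hx2 : Filter.Tendsto (fun n => (x n).2) Filter.atTop (nhds k) :=
    (continuous_snd.tendsto _).comp hlim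
  have hx1 : Filter.Tendsto (fun n => (x n).1) Filter.atTop (nhds f) :=
    (continuous_fst.tendsto _).comp hlim
  have hcau : CauchySeq y := by
    have := hx2.cauchySeq
    rw [Metric.cauchySeq_iff] at this ⊢
    simpa only [hdist] using this
  obtain ⟨k', hk'⟩ := cauchySeq_tendsto_of_complete hcau
  refine ⟨k', (isClosed_operPart hT₂).mem_of_tendsto (hx1.prodMk_nhds hk')
    (Filter.Eventually.of_forall hy), tendsto_nhds_unique hk'.norm ?_⟩
  simpa only [hyn] using hx2.norm

theorem dom_le_of_gram_eq {T₁ : LinRel E F₁} {T₂ : LinRel E F₂}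
    (hT₁ : IsClosed (T₁ : Set (E × F₁))) (hT₂ : IsClosed (T₂ : Set (E × F₂)))
    (h : gram T₁ = gram T₂) : dom (operPart T₁) ≤ dom (operPart T₂) := by
  intro f hf
  obtain ⟨k, hk⟩ := mem_dom_iff.mp hf
  obtain ⟨k', hk', -⟩ := exists_mem_operPart_of_gram_eq hT₁ hT₂ h hk
  exact mem_dom_iff.mpr ⟨k', hk'⟩

omit [CompleteSpace E] in
theorem IsSqrt.isClosed {K L : LinRel E E} (h : IsSqrt K L) : IsClosed (K : Set (E × E)) :=
  h.1.1 ▸ isClosed_adjoint K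

omit [CompleteSpace E] in
-- Treats a square root as one more closed relation with the given `T* T`, so the comparison applies
-- to any choice of square roots and their uniqueness is not needed.
theorem IsSqrt.gram_eq {K L : LinRel E E} (h : IsSqrt K L) : gram K = L := by
  rw [gram, h.1.1, h.2]

/-- The order of the relations `T* T` in terms of the operator parts of the relations `T`. -/
theorem leSqMul_gram_iff {T₁ : LinRel E F₁} {T₂ : LinRel E F₂}
    (hT₁ : IsClosed (T₁ : Set (E × F₁))) (hT₂ : IsClosed (T₂ : Set (E × F₂))) {c : ℝ} :
    LeSqMul c (gram T₁) (gram T₂) ↔ dom (operPart T₂) ≤ dom (operPart T₁) ∧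
      ∀ h k₁ k₂, (h, k₁) ∈ operPart T₁ → (h, k₂) ∈ operPart T₂ → ‖k₁‖ ≤ c * ‖k₂‖ := by
  constructor
  · rintro ⟨K₁, K₂, hK₁, hK₂, hd, hn⟩
    refine ⟨(dom_le_of_gram_eq hT₂ hK₂.isClosed hK₂.gram_eq.symm).trans
      (hd.trans (dom_le_of_gram_eq hK₁.isClosed hT₁ hK₁.gram_eq)), ?_⟩
    intro h k₁ k₂ h₁ h₂
    obtain ⟨l₁, hl₁, hln₁⟩ :=
      exists_mem_operPart_of_gram_eq hT₁ hK₁.isClosed hK₁.gram_eq.symm h₁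
    obtain ⟨l₂, hl₂, hln₂⟩ :=
      exists_mem_operPart_of_gram_eq hT₂ hK₂.isClosed hK₂.gram_eq.symm h₂
    rw [← hln₁, ← hln₂]
    exact hn _ _ _ hl₁ hl₂
  · rintro ⟨hd, hn⟩
    obtain ⟨K₁, hK₁⟩ := exists_isSqrt_gram hT₁
    obtain ⟨K₂, hK₂⟩ := exists_isSqrt_gram hT₂
    refine ⟨K₁, K₂, hK₁, hK₂, (dom_le_of_gram_eq hK₂.isClosed hT₂ hK₂.gram_eq).trans
      (hd.trans (dom_le_of_gram_eq hT₁ hK₁.isClosed hK₁.gram_eq.symm)), ?_⟩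
    intro h k₁ k₂ h₁ h₂
    obtain ⟨l₁, hl₁, hln₁⟩ := exists_mem_operPart_of_gram_eq hK₁.isClosed hT₁ hK₁.gram_eq h₁
    obtain ⟨l₂, hl₂, hln₂⟩ := exists_mem_operPart_of_gram_eq hK₂.isClosed hT₂ hK₂.gram_eq h₂
    rw [← hln₁, ← hln₂]
    exact hn _ _ _ hl₁ hl₂

/-! ### Douglas factorization -/

omit [CompleteSpace E] in
/-- Douglas factorization: if `‖k₁‖ ≤ c ‖k₂‖` for the values `k₁`, `k₂` of the operator parts, then
the operator part of `T₁` factors on the common domain through the operator part of `T₂`. -/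
theorem exists_factor {T₁ : LinRel E F₁} {T₂ : LinRel E F₂} {c : ℝ} (hc : 0 ≤ c)
    (hn : ∀ h k₁ k₂, (h, k₁) ∈ operPart T₁ → (h, k₂) ∈ operPart T₂ → ‖k₁‖ ≤ c * ‖k₂‖) :
    ∃ C : F₂ →L[ℂ] F₁, ‖C‖ ≤ c ∧
      (∀ h k₁ k₂, (h, k₁) ∈ operPart T₁ → (h, k₂) ∈ operPart T₂ → C k₂ = k₁) ∧
      ∀ m ∈ mul T₂, C m = 0 := by
  -- `W` consists of the triples `(h, T₁ₛ h, T₂ₛ h)` and `V` of their last entries. The map `C` is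
  -- prescribed as `T₂ₛ h ↦ T₁ₛ h` on `V` and as `0` on `Vᗮ`, then extended by continuity from the
  -- dense subspace `V + Vᗮ`. It kills `mul T₂` because `mul T₂` is orthogonal to `V`.
  let W : Submodule ℂ (E × F₁ × F₂) :=
    (operPart T₁).comap (LinearMap.prodMap LinearMap.id (LinearMap.fst ℂ F₁ F₂)) ⊓
      (operPart T₂).comap (LinearMap.prodMap LinearMap.id (LinearMap.snd ℂ F₁ F₂))
  let V : Submodule ℂ F₂ := W.map (LinearMap.snd ℂ F₁ F₂ ∘ₗ LinearMap.snd ℂ E (F₁ × F₂))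
  let a : W × Vᗮ →ₗ[ℂ] F₁ :=
    LinearMap.fst ℂ F₁ F₂ ∘ₗ LinearMap.snd ℂ E (F₁ × F₂) ∘ₗ W.subtype ∘ₗ LinearMap.fst ℂ W Vᗮ
  let e : W × Vᗮ →ₗ[ℂ] F₂ :=
    (LinearMap.snd ℂ F₁ F₂ ∘ₗ LinearMap.snd ℂ E (F₁ × F₂) ∘ₗ W.subtype).coprod Vᗮ.subtype
  have he : ∀ (w : W) (v : Vᗮ), e (w, v) = (w : E × F₁ × F₂).2.2 + v := fun w v => rfl
  have ha : ∀ (w : W) (v : Vᗮ), a (w, v) = (w : E × F₁ × F₂).2.1 := fun w v => rfl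
  have hV : ∀ w : W, (w : E × F₁ × F₂).2.2 ∈ V := fun w => ⟨w, w.2, rfl⟩
  have hdense : DenseRange e := by
    have : LinearMap.range e = V ⊔ Vᗮ := by
      rw [LinearMap.range_coprod, Submodule.range_subtype, ← LinearMap.comp_assoc,
        LinearMap.range_comp, Submodule.range_subtype]
    rw [DenseRange, ← LinearMap.coe_range, this, Submodule.dense_iff_topologicalClosure_eq_top,
      Submodule.topologicalClosure_eq_top_iff, ← Submodule.inf_orthogonal]
    exact (Vᗮ).inf_orthogonal_eq_bot
  have hbound : ∀ x, ‖a x‖ ≤ c * ‖e x‖ := by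
    rintro ⟨w, v⟩
    rw [he, ha]
    -- By Pythagoras, the `Vᗮ` summand only increases the norm on the right.
    refine (hn _ _ _ w.2.1 w.2.2).trans (mul_le_mul_of_nonneg_left ?_ hc)
    have h0 : ⟪(w : E × F₁ × F₂).2.2, (v : F₂)⟫_ℂ = 0 :=
      V.inner_right_of_mem_orthogonal (hV w) v.2
    have := norm_add_sq_eq_norm_sq_add_norm_sq_of_inner_eq_zero _ _ h0
    change ‖(w : E × F₁ × F₂).2.2‖ ≤ _
    nlinarith [norm_nonneg (w : E × F₁ × F₂).2.2, norm_nonneg ((w : E × F₁ × F₂).2.2 + (v : F₂)),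
      mul_self_nonneg ‖(v : F₂)‖]
  refine ⟨a.extendOfNorm e, LinearMap.opNorm_extendOfNorm_le hdense hc hbound, ?_, ?_⟩
  · intro h k₁ k₂ h₁ h₂
    have := LinearMap.extendOfNorm_eq hdense ⟨c, hbound⟩ (⟨(h, k₁, k₂), h₁, h₂⟩, 0)
    simpa [he, ha] using this
  · intro m hm
    have hmV : m ∈ Vᗮ := by
      rw [Submodule.mem_orthogonal]
      rintro _ ⟨w, hw, rfl⟩
      exact (mul T₂).inner_left_of_mem_orthogonal hm hw.2.2
    have := LinearMap.extendOfNorm_eq hdense ⟨c, hbound⟩ (0, ⟨m, hmV⟩)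
    simpa [he, ha] using this

omit [CompleteSpace E] in
-- For `s ⊥ mul T₁`, membership of `(s, f')` in `T₁*` tests `s` only against the vectors `T₁ₛ k = C
-- l` with `(k, l) ∈ T₂`, and `(C l, s) = (l, C* s)`. Because `dom T₁ = dom T₂`, no test is lost in
-- either direction, so `T₁* s = T₂* C* s`; inserting `s = C φ` gives `C* C` in the middle.
theorem gram_eq_of_factor {T₁ : LinRel E F₁} {T₂ : LinRel E F₂}
    (hT₁ : IsClosed (T₁ : Set (E × F₁))) (hT₂ : IsClosed (T₂ : Set (E × F₂)))
    (hd : dom T₁ = dom T₂) {C : F₂ →L[ℂ] F₁}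
    (hC : ∀ h k₁ k₂, (h, k₁) ∈ operPart T₁ → (h, k₂) ∈ operPart T₂ → C k₂ = k₁)
    (hC0 : ∀ m ∈ mul T₂, C m = 0) :
    gram T₁ = comp (Submodule.adjoint T₂) (comp (ofCLM (C.adjoint ∘L C)) T₂) := by
  have hCT : ∀ {h k₁ l}, (h, k₁) ∈ operPart T₁ → (h, l) ∈ T₂ → C l = k₁ := by
    intro h k₁ l h₁ h₂
    obtain ⟨k₂, hk₂, hm⟩ := exists_mem_operPart_sub_mem_mul hT₂ h₂
    rw [← hC _ _ _ h₁ hk₂, ← sub_eq_zero, ← map_sub, hC0 _ hm]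
  have hadj : ∀ {s : F₁}, s ∈ (mul T₁)ᗮ → ∀ {f' : E},
      (s, f') ∈ Submodule.adjoint T₁ ↔ (C.adjoint s, f') ∈ Submodule.adjoint T₂ := by
    intro s hs f'
    simp only [mk_mem_adjoint_iff, ContinuousLinearMap.adjoint_inner_right]
    constructor
    · intro H k l hkl
      obtain ⟨l₁, hl₁⟩ := mem_dom_iff.mp (hd ▸ mem_dom_iff.mpr ⟨l, hkl⟩ : k ∈ dom T₁)
      obtain ⟨k₁, hk₁, -⟩ := exists_mem_operPart_sub_mem_mul hT₁ hl₁
      rw [hCT hk₁ hkl, H _ _ hk₁.1]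
    · intro H k l hkl
      obtain ⟨l₂, hl₂⟩ := mem_dom_iff.mp (hd ▸ mem_dom_iff.mpr ⟨l, hkl⟩ : k ∈ dom T₂)
      obtain ⟨k₁, hk₁, hm⟩ := exists_mem_operPart_sub_mem_mul hT₁ hkl
      have := (mul T₁).inner_right_of_mem_orthogonal hm hs
      rw [inner_sub_left, sub_eq_zero] at this
      rw [this, ← H _ _ hl₂, hCT hk₁ hl₂]
  ext ⟨f, f'⟩
  rw [mem_gram_iff_exists_operPart]
  constructor
  · rintro ⟨s, hs, hs'⟩
    obtain ⟨l, hl⟩ := mem_dom_iff.mp (hd ▸ mem_dom_iff.mpr ⟨s, hs.1⟩ : f ∈ dom T₂)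
    refine ⟨C.adjoint s, ⟨l, hl, ?_⟩, (hadj hs.2).mp hs'⟩
    simp [ofCLM, LinearMap.mem_graph_iff, hCT hs hl]
  · rintro ⟨ψ, ⟨φ, hφ, hψ⟩, hf'⟩
    obtain ⟨l, hl⟩ := mem_dom_iff.mp (hd ▸ mem_dom_iff.mpr ⟨φ, hφ⟩ : f ∈ dom T₁)
    obtain ⟨s, hs, -⟩ := exists_mem_operPart_sub_mem_mul hT₁ hl
    refine ⟨s, hs, (hadj hs.2).mpr ?_⟩
    simp only [ofCLM, LinearMap.mem_graph_iff] at hψ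
    change ψ = C.adjoint (C φ) at hψ
    rw [hψ, hCT hs hφ] at hf'
    exact hf'

/-! ### From the factorization back to the inequality -/

omit [CompleteSpace E] [CompleteSpace F₁] [CompleteSpace F₂] in
theorem norm_le_of_mem_comp_ofCLM {T₁ : LinRel E F₁} {T₂ : LinRel E F₂} {M : F₂ →L[ℂ] F₂}
    (hM : M.IsPositive) {c : ℝ} (hc : 0 ≤ c) (hMc : ‖M‖ ≤ c ^ 2)
    (h : gram T₁ ≤ comp (Submodule.adjoint T₂) (comp (ofCLM M) T₂)) {f f' : E} {s : F₁} {t : F₂}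
    (hs : (f, s) ∈ T₁) (hs' : (s, f') ∈ Submodule.adjoint T₁) (ht : (f, t) ∈ T₂) :
    ‖s‖ ≤ c * ‖t‖ := by
  obtain ⟨ψ, ⟨φ, hφ, hψ⟩, hf'⟩ := h (mem_gram_iff.mpr ⟨s, hs, hs'⟩)
  simp only [ofCLM, LinearMap.mem_graph_iff] at hψ
  change ψ = M φ at hψ
  subst hψ
  -- The factorization may select a value `φ` of `T₂` at `f` other than `t`. Since `M φ ∈ dom T₂*`
  -- is orthogonal to `m ∈ mul T₂`, the discrepancy has the favourable sign: `‖s‖² = (M t, t) - (M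
  -- m, m) ≤ c² ‖t‖²`.
  obtain ⟨m, rfl⟩ : ∃ m, φ = t + m := ⟨φ - t, by abel⟩
  have hm : m ∈ mul T₂ := by simpa [mem_mul_iff] using T₂.sub_mem hφ ht
  have h1 : ‖s‖ ^ 2 = (⟪t, M (t + m)⟫_ℂ).re := by
    rw [norm_sq_eq_re_inner_of_mem_gram hs hs', mk_mem_adjoint_iff.mp hf' _ _ ht]
  have h2 : (⟪m, M (t + m)⟫_ℂ).re = 0 := by
    rw [(mul T₂).inner_right_of_mem_orthogonal hm (mem_orthogonal_mul_of_mem_adjoint hf')]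
    rfl
  have h3 : (⟪t, M m⟫_ℂ).re = (⟪m, M t⟫_ℂ).re := by
    rw [← hM.inner_left_eq_inner_right, ← inner_conj_symm, Complex.conj_re]
  have h4 : 0 ≤ (⟪m, M m⟫_ℂ).re := hM.re_inner_nonneg_right m
  have h5 : (⟪t, M t⟫_ℂ).re ≤ c ^ 2 * ‖t‖ ^ 2 := calc
    (⟪t, M t⟫_ℂ).re ≤ ‖t‖ * ‖M t‖ := re_inner_le_norm (𝕜 := ℂ) t (M t)
    _ ≤ ‖t‖ * (c ^ 2 * ‖t‖) := by gcongr; exact M.le_of_opNorm_le hMc t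
    _ = c ^ 2 * ‖t‖ ^ 2 := by ring
  simp only [map_add, inner_add_right, Complex.add_re] at h1 h2
  refine le_of_sq_le_sq ?_ (by positivity)
  rw [mul_pow]
  linarith

/-- A bound between the operator parts of closed relations with the same domain follows from the
bound on a core. -/
theorem norm_operPart_le_of_core {T₁ : LinRel E F₁} {T₂ : LinRel E F₂}
    (hT₁ : IsClosed (T₁ : Set (E × F₁))) (hT₂ : IsClosed (T₂ : Set (E × F₂)))
    (hd : dom (operPart T₁) ≤ dom (operPart T₂)) {S : Set (E × F₁)} (hS : S ⊆ operPart T₁)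
    (hcore : (operPart T₁ : Set (E × F₁)) ⊆ closure S) {c : ℝ}
    (hn : ∀ h k₁ k₂, (h, k₁) ∈ S → (h, k₂) ∈ operPart T₂ → ‖k₁‖ ≤ c * ‖k₂‖)
    {h : E} {k₁ : F₁} {k₂ : F₂} (h₁ : (h, k₁) ∈ operPart T₁) (h₂ : (h, k₂) ∈ operPart T₂) :
    ‖k₁‖ ≤ c * ‖k₂‖ := by
  have : CompleteSpace (operPart T₁) := (isClosed_operPart hT₁).completeSpace_coe
  have hex : ∀ x : operPart T₁, ∃ t, ((x : E × F₁).1, t) ∈ operPart T₂ := fun x =>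
    mem_dom_iff.mp (hd (mem_dom_iff.mpr ⟨_, x.2⟩))
  choose g hg using hex
  let G : operPart T₁ →ₗ[ℂ] F₂ :=
    { toFun := g
      map_add' := fun x y => operPart_unique (hg (x + y)) ((operPart T₂).add_mem (hg x) (hg y))
      map_smul' := fun a x => operPart_unique (hg (a • x)) ((operPart T₂).smul_mem a (hg x)) }
  -- Closed graph theorem: `T₂ₛ` is bounded with respect to the graph norm of `T₁ₛ`, so values of
  -- `T₂ₛ` converge along sequences from the core.
  have hGcont : Continuous G := by
    refine G.continuous_of_seq_closed_graph fun u x y hu hGu => ?_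
    have hu' : Filter.Tendsto (fun n => ((u n : E × F₁)).1) Filter.atTop
        (nhds (x : E × F₁).1) :=
      ((continuous_fst.comp continuous_subtype_val).tendsto x).comp hu
    exact operPart_unique ((isClosed_operPart hT₂).mem_of_tendsto (hu'.prodMk_nhds hGu)
      (Filter.Eventually.of_forall fun n => hg (u n))) (hg x)
  obtain ⟨x, hx, hlim⟩ := mem_closure_iff_seq_limit.mp (hcore h₁)
  let u : ℕ → operPart T₁ := fun n => ⟨x n, hS (hx n)⟩
  have hu : Filter.Tendsto u Filter.atTop (nhds ⟨(h, k₁), h₁⟩) := tendsto_subtype_rng.mpr hlim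
  have hGu := (hGcont.tendsto _).comp hu
  have hGk : G ⟨(h, k₁), h₁⟩ = k₂ := operPart_unique (hg _) h₂
  rw [hGk] at hGu
  exact le_of_tendsto_of_tendsto' ((continuous_snd.tendsto _).comp hlim).norm
    (hGu.norm.const_mul c) fun n => hn _ _ _ (hx n) (hg (u n))

/-- The factorization theorem for `T₁* T₁` and `T₂* T₂`. -/
theorem leSqMul_gram_iff_exists_isPositive {T₁ : LinRel E F₁} {T₂ : LinRel E F₂}
    (hT₁ : IsClosed (T₁ : Set (E × F₁))) (hT₂ : IsClosed (T₂ : Set (E × F₂)))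
    (hd : dom T₁ = dom T₂) {c : ℝ} (hc : 0 ≤ c) :
    LeSqMul c (gram T₁) (gram T₂) ↔ ∃ M : F₂ →L[ℂ] F₂, M.IsPositive ∧ ‖M‖ ≤ c ^ 2 ∧
      gram T₁ = comp (Submodule.adjoint T₂) (comp (ofCLM M) T₂) := by
  have hd' : dom (operPart T₁) = dom (operPart T₂) := by
    rw [dom_operPart hT₁, dom_operPart hT₂, hd]
  rw [leSqMul_gram_iff hT₁ hT₂]
  constructor
  · rintro ⟨-, hn⟩
    obtain ⟨C, hCc, hC, hC0⟩ := exists_factor hc hn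
    refine ⟨C.adjoint ∘L C, ContinuousLinearMap.isPositive_adjoint_comp_self C, ?_,
      gram_eq_of_factor hT₁ hT₂ hd hC hC0⟩
    rw [ContinuousLinearMap.norm_adjoint_comp_self, pow_two]
    gcongr
  · rintro ⟨M, hM, hMc, h⟩
    refine ⟨hd'.ge, fun f k₁ k₂ h₁ h₂ => ?_⟩
    refine norm_operPart_le_of_core hT₁ hT₂ hd'.le (fun x hx => hx.1)
      (operPart_subset_closure hT₁) ?_ h₁ h₂
    rintro f s t ⟨hs, f', hs'⟩ ht
    exact norm_le_of_mem_comp_ofCLM hM hc hMc h.le hs.1 hs' ht.1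

end Comparison

end LinRel

theorem proposition3p8
    {HA HB H : Type*}
    [NormedAddCommGroup HA] [InnerProductSpace ℂ HA] [CompleteSpace HA]
    [NormedAddCommGroup HB] [InnerProductSpace ℂ HB] [CompleteSpace HB]
    [NormedAddCommGroup H] [InnerProductSpace ℂ H] [CompleteSpace H]
    (A : LinRel HA H) (B : LinRel HB H)
    (hA : IsClosed (A : Set (HA × H))) (hB : IsClosed (B : Set (HB × H)))
    (hdom : LinRel.dom (Submodule.adjoint A) = LinRel.dom (Submodule.adjoint B))
    (c : ℝ) (hc : 0 ≤ c) :
    LinRel.LeSqMul c (LinRel.comp A (Submodule.adjoint A)) (LinRel.comp B (Submodule.adjoint B)) ↔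
      ∃ M : HB →L[ℂ] HB, M.IsPositive ∧ ‖M‖ ≤ c ^ 2 ∧
        LinRel.comp A (Submodule.adjoint A) =
          LinRel.comp B (LinRel.comp (LinRel.ofCLM M) (Submodule.adjoint B)) := by
  have := LinRel.leSqMul_gram_iff_exists_isPositive (LinRel.isClosed_adjoint A)
    (LinRel.isClosed_adjoint B) hdom hc
  simpa only [LinRel.gram, LinRel.adjoint_adjoint hA, LinRel.adjoint_adjoint hB] using this
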